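/- Let $M$ be a Hausdorff smooth manifold (without boundary) of dimension $n \ge 0$, let $C^\infty(M)$ be the ring of smooth functions $M \to \mathbb{R}$, and let $\mathfrak{X}(M)$ be the $C^\infty(M)$-module of smooth vector fields on $M$. A finite family $(X_i)_{i \in I}$ in $\mathfrak{X}(M)$ is called a generating set if every $X \in \mathfrak{X}(M)$ can be written as $X = \sum_{i \in I} f_i X_i$ with $f_i \in C^\infty(M)$. (1) Let $X_1, \dots, X_m \in \mathfrak{X}(M)$ be such that $\operatorname{span}\{X_1(q), \dots, X_m(q)\} = T_qM$ for every $q \in M$. Then $\{X_1, \dots, X_m\}$ is a generating set. (2) If $M$ is second countable, then $\mathfrak{X}(M)$ is a finitely generated $C^\infty(M)$-module. (3) If $M$ is second countable, then $M$ has a trivialising cover by $n+1$ sets, that is, there are open sets $U_0, \dots, U_n$ covering $M$ and, for each $i$, a smooth local frame $E^{(i)}_1, \dots, E^{(i)}_n$ of $TM$ over $U_i$. For any such cover and frames there is a smooth partition of unity $\psi_0, \dots, \psi_n$ with $\operatorname{supp} \psi_i \subseteq U_i$. For every such partition of unity the $n(n+1)$ vector fields $\psi_i E^{(i)}_j$ ($0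 \le i \le n$, $1 \le j \le n$), extended by $0$ outside $U_i$, are smooth on $M$, span every tangent space of $M$ and form a generating set. -/

import Mathlib

open scoped Manifold ContDiff

noncomputable section

/-- The smooth real functions `C^∞(M)` on a manifold modelled on `ℝⁿ`. -/
abbrev SmoothFunction (n : ℕ) (M : Type*) [TopologicalSpace M]
    [ChartedSpace (EuclideanSpace ℝ (Fin n)) M] : Type _ :=
  C^∞⟮𝓡 n, M; 𝓘(ℝ, ℝ), ℝ⟯

/-- The smooth vector fields on a manifold modelled on `ℝⁿ`: smooth sections of its tangent
bundle. -/
abbrev SmoothVectorField (n : ℕ) (M : Type*) [TopologicalSpace M]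
    [ChartedSpace (EuclideanSpace ℝ (Fin n)) M] [IsManifold (𝓡 n) ∞ M] : Type _ :=
  Cₛ^∞⟮𝓡 n; EuclideanSpace ℝ (Fin n), fun x : M => TangentSpace (𝓡 n) x⟯

namespace SmoothVectorField

variable {n : ℕ} {M : Type*} [TopologicalSpace M]
  [ChartedSpace (EuclideanSpace ℝ (Fin n)) M] [IsManifold (𝓡 n) ∞ M]

/-- The pointwise product `(f • X)_x = f(x) X_x` of a smooth function and a smooth vector field. -/
instance instSMulSmoothFunction : SMul (SmoothFunction n M) (SmoothVectorField n M) where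
  smul f X := ⟨fun x => f x • X x, f.contMDiff.smul_section X.contMDiff⟩

theorem smul_apply (f : SmoothFunction n M) (X : SmoothVectorField n M) (x : M) :
    (f • X) x = f x • X x := rfl

/-- The smooth vector fields form a module over the ring of smooth functions, with the pointwise
operations. -/
instance instModuleSmoothFunction : Module (SmoothFunction n M) (SmoothVectorField n M) where
  one_smul X := ContMDiffSection.ext fun x => one_smul ℝ (X x)
  mul_smul f g X := ContMDiffSection.ext fun x => mul_smul (f x) (g x) (X x)
  smul_zero f := ContMDiffSection.ext fun x => smul_zero (f x)
  smul_add f X Y := ContMDiffSection.ext fun x => smul_add (f x) (X x) (Y x)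
  add_smul f g X := ContMDiffSection.ext fun x => add_smul (f x) (g x) (X x)
  zero_smul X := ContMDiffSection.ext fun x => zero_smul ℝ (X x)

/-- The finite family `X` generates the `C^∞(M)`-module of smooth vector fields: every smooth
vector field is a combination of the `X i` with smooth coefficients. -/
def IsGeneratingFamily {ι : Type*} [Fintype ι] (X : ι → SmoothVectorField n M) : Prop :=
  ∀ V : SmoothVectorField n M, ∃ f : ι → SmoothFunction n M, V = ∑ i, f i • X i

/-- The vector fields `X i` span every tangent space. -/
def SpansTangentSpaces {ι : Type*} (X : ι → SmoothVectorField n M) : Prop :=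
  ∀ x : M, Submodule.span ℝ (Set.range fun i => X i x) = ⊤

end SmoothVectorField

/-- `U` is an open cover of `M` that trivialises the tangent bundle: on `U i` the vector fields
`E i 1, …, E i n` form a smooth local frame (their values off `U i` are irrelevant). -/
structure IsTrivialisingCover {n : ℕ} {M : Type*} [TopologicalSpace M]
    [ChartedSpace (EuclideanSpace ℝ (Fin n)) M] [IsManifold (𝓡 n) ∞ M] {ι : Type*}
    (U : ι → Set M) (E : ι → Fin n → (x : M) → TangentSpace (𝓡 n) x) : Prop where
  isOpen : ∀ i, IsOpen (U i)
  iUnion_eq : ⋃ i, U i = Set.univ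
  isLocalFrameOn : ∀ i, IsLocalFrameOn (𝓡 n) (EuclideanSpace ℝ (Fin n)) ∞ (E i) (U i)

end

/-!
Suppose that `v₁, …, vₘ` span a finite-dimensional space, and let `w` be a vector. Among all
coefficients `c` with `∑ cᵢ vᵢ = w` there is exactly one choice of the form `cᵢ = φ vᵢ` with a
linear form `φ`. Being unique, and preserved by linear isomorphisms, it can be computed in any
trivialisation of a vector bundle, where `φ` is the solution of a linear equation with smooth
invertible coefficients. So sections spanning every fibre generate all sections with smooth
coefficients, and no partition of unity is needed.

For the cover, cut a locally finite family of bump functions at levels such that no point lies on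
more than `n` of the level sets; by the easy case of Sard's theorem and Baire's theorem almost
every choice of levels does this. In the cover by the superlevel sets, the points lying on exactly
`k` of the frontiers, `0 ≤ k ≤ n`, form a stratum on which the set of members containing a point
is locally constant. So each stratum splits into disjoint relatively open pieces, each inside a
single member, and these thicken to disjoint open sets. On each of the `n + 1` resulting unions
local frames glue.
-/

open Set Filter Function Topology Module

section CanonicalCoefficients

theorem span_range_linearMap_eq_top {ι K V W : Type*} [Semiring K] [AddCommMonoid V] [Module K V]
    [AddCommMonoid W] [Module K W] {v : ι → V} (hv : Submodule.span K (range v) = ⊤)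
    {L : V →ₗ[K] W} (hL : Surjective L) : Submodule.span K (range fun i => L (v i)) = ⊤ := by
  rw [← comp_def, range_comp, ← Submodule.map_span, hv, Submodule.map_top,
    LinearMap.range_eq_top.2 hL]

/-- `c` is the canonical coefficient vector writing `w` as a combination of the family `v`: the
`c i` are the values at the `v i` of one linear form. Equivalently `c` is orthogonal to all linear
relations between the `v i`, so over `ℝ` it is the coefficient vector of least Euclidean norm; the
linear form serves to state this without a norm on `V`. -/
structure IsCanonicalCoeff {ι K V : Type*} [Fintype ι] [CommRing K] [AddCommGroup V] [Module K V]
    (v : ι → V) (w : V) (c : ι → K) : Prop where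
  exists_dual : ∃ φ : Dual K V, ∀ i, c i = φ (v i)
  sum_smul : ∑ i, c i • v i = w

namespace IsCanonicalCoeff

variable {ι K V W : Type*} [Fintype ι] [CommRing K] [AddCommGroup V] [Module K V]
  [AddCommGroup W] [Module K W] {v : ι → V} {w : V} {c c' : ι → K}

theorem map (hc : IsCanonicalCoeff v w c) (L : V ≃ₗ[K] W) :
    IsCanonicalCoeff (fun i => L (v i)) (L w) c := by
  obtain ⟨φ, hφ⟩ := hc.exists_dual
  exact ⟨⟨φ ∘ₗ L.symm, fun i => by simp [hφ]⟩, by simp [← hc.sum_smul]⟩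

theorem eq [LinearOrder K] [IsStrictOrderedRing K] (hc : IsCanonicalCoeff v w c)
    (hc' : IsCanonicalCoeff v w c') : c = c' := by
  obtain ⟨φ, hφ⟩ := hc.exists_dual
  obtain ⟨φ', hφ'⟩ := hc'.exists_dual
  have hrel : ∑ i, (c i - c' i) • v i = 0 := by
    simp only [sub_smul, Finset.sum_sub_distrib, hc.sum_smul, hc'.sum_smul, sub_self]
  have hsq : ∑ i, (c i - c' i) * (c i - c' i) = 0 := by
    simpa [hφ, hφ'] using congrArg (φ - φ') hrel
  funext i
  have hi := (Finset.sum_eq_zero_iff_of_nonneg fun i _ => mul_self_nonneg (c i - c' i)).1 hsq i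
    (Finset.mem_univ i)
  exact sub_eq_zero.1 (mul_self_eq_zero.1 hi)

end IsCanonicalCoeff

variable {ι F : Type*} [Fintype ι] [NormedAddCommGroup F] [NormedSpace ℝ F]

/-- The operator `φ ↦ ∑ i, φ (v i) • v i`: a solution `φ` of `frameOperator v φ = w` is a linear
form whose values are the canonical coefficients of `w`. It lives on the dual of `F` so that no
inner product on `F` is needed. -/
noncomputable def frameOperator (v : ι → F) : StrongDual ℝ F →L[ℝ] F :=
  ∑ i, (NormedSpace.inclusionInDoubleDual ℝ F (v i)).smulRight (v i)

theorem frameOperator_apply (v : ι → F) (φ : StrongDual ℝ F) :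
    frameOperator v φ = ∑ i, φ (v i) • v i := by
  simp [frameOperator]

theorem contDiff_frameOperator {k : ℕ∞ω} :
    ContDiff ℝ k (frameOperator : (ι → F) → StrongDual ℝ F →L[ℝ] F) := by
  unfold frameOperator
  fun_prop

theorem frameOperator_injective {v : ι → F} (hv : Submodule.span ℝ (range v) = ⊤) :
    Injective (frameOperator v) := by
  refine (injective_iff_map_eq_zero _).2 fun φ hφ => ?_
  have hsq : ∑ i, φ (v i) * φ (v i) = 0 := by
    simpa [frameOperator_apply] using congrArg φ hφ
  have hzero : ∀ i, φ (v i) = 0 := fun i => mul_self_eq_zero.1 <|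
    (Finset.sum_eq_zero_iff_of_nonneg fun i _ => mul_self_nonneg (φ (v i))).1 hsq i
      (Finset.mem_univ i)
  refine ContinuousLinearMap.coe_injective (LinearMap.ext_on_range hv fun i => ?_)
  simpa using hzero i

theorem exists_continuousLinearEquiv_eq_frameOperator {v : ι → F}
    (hv : Submodule.span ℝ (range v) = ⊤) :
    ∃ T : StrongDual ℝ F ≃L[ℝ] F, (T : StrongDual ℝ F →L[ℝ] F) = frameOperator v := by
  have : FiniteDimensional ℝ F := .of_fg_top (hv ▸ Submodule.fg_span (finite_range v))
  have hfinrank : finrank ℝ (StrongDual ℝ F) = finrank ℝ F :=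
    (LinearMap.toContinuousLinearMap (𝕜 := ℝ) (E := F) (F' := ℝ)).finrank_eq.symm.trans
      Subspace.dual_finrank_eq
  exact ⟨(LinearEquiv.ofInjectiveOfFinrankEq (frameOperator v).toLinearMap
    (frameOperator_injective hv) hfinrank).toContinuousLinearEquiv, rfl⟩

/-- The canonical coefficients as a function of `v` and `w`. If `v` does not span `F`, then
`frameOperator v` has the junk inverse `0`. -/
noncomputable def canonicalCoeff (v : ι → F) (w : F) (i : ι) : ℝ :=
  (frameOperator v).inverse w (v i)

theorem isCanonicalCoeff_canonicalCoeff {v : ι → F} (hv : Submodule.span ℝ (range v) = ⊤)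
    (w : F) : IsCanonicalCoeff v w (canonicalCoeff v w) := by
  obtain ⟨T, hT⟩ := exists_continuousLinearEquiv_eq_frameOperator hv
  refine ⟨⟨((frameOperator v).inverse w).toLinearMap, fun i => rfl⟩, ?_⟩
  simp only [canonicalCoeff, ← frameOperator_apply, ← hT, ContinuousLinearMap.inverse_equiv]
  exact T.apply_symm_apply w

theorem contDiffAt_canonicalCoeff {k : ℕ∞ω} {v : ι → F}
    (hv : Submodule.span ℝ (range v) = ⊤) (w : F) (i : ι) :
    ContDiffAt ℝ k (fun p : (ι → F) × F => canonicalCoeff p.1 p.2 i) (v, w) := by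
  have : FiniteDimensional ℝ F := .of_fg_top (hv ▸ Submodule.fg_span (finite_range v))
  have : CompleteSpace F := FiniteDimensional.complete ℝ F
  obtain ⟨T, hT⟩ := exists_continuousLinearEquiv_eq_frameOperator hv
  have hinv : ContDiffAt ℝ k (fun p : (ι → F) × F => (frameOperator p.1).inverse) (v, w) := by
    refine ContDiffAt.comp (g := ContinuousLinearMap.inverse) (v, w) ?_
      (contDiff_frameOperator.comp contDiff_fst).contDiffAt
    simpa only [comp_apply, ← hT] using contDiffAt_map_inverse T
  exact (hinv.clm_apply contDiffAt_snd).clm_apply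
    ((contDiff_apply ℝ F i).comp contDiff_fst).contDiffAt

end CanonicalCoefficients

section Sections

open Bundle

variable {ι E H F M : Type*} {V : M → Type*} [NormedAddCommGroup E] [NormedSpace ℝ E]
  [TopologicalSpace H] {I : ModelWithCorners ℝ E H} {k : ℕ∞ω} [NormedAddCommGroup F]
  [NormedSpace ℝ F] [TopologicalSpace M] [ChartedSpace H M] [TopologicalSpace (TotalSpace F V)]
  [∀ x, AddCommGroup (V x)] [∀ x, Module ℝ (V x)] [∀ x, TopologicalSpace (V x)]
  [FiberBundle F V]

/-- The sections `X i` span every fibre of the vector bundle. -/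
def SpansFibers (X : ι → Cₛ^k⟮I; F, V⟯) : Prop :=
  ∀ x, Submodule.span ℝ (range fun i => X i x) = ⊤

/-- Every `C^k` section is a combination of the finitely many sections `X i` with `C^k`
coefficients. The combination is taken pointwise because Mathlib has no module structure of the
sections over the `C^k` functions. -/
def GeneratesSections [Fintype ι] (X : ι → Cₛ^k⟮I; F, V⟯) : Prop :=
  ∀ s : Cₛ^k⟮I; F, V⟯, ∃ f : ι → C^k⟮I, M; 𝓘(ℝ, ℝ), ℝ⟯, ∀ x, s x = ∑ i, f i x • X i x

theorem GeneratesSections.exists_fin [Fintype ι] {X : ι → Cₛ^k⟮I; F, V⟯}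
    (hX : GeneratesSections X) :
    ∃ (m : ℕ) (Y : Fin m → Cₛ^k⟮I; F, V⟯), GeneratesSections Y := by
  let e := Fintype.equivFin ι
  refine ⟨Fintype.card ι, X ∘ e.symm, fun s => ?_⟩
  obtain ⟨f, hf⟩ := hX s
  refine ⟨f ∘ e.symm, fun x => (hf x).trans ?_⟩
  exact (e.symm.sum_comp fun i => f i x • X i x).symm

namespace SpansFibers

variable [VectorBundle ℝ F V] [Fintype ι] {X : ι → Cₛ^k⟮I; F, V⟯}

theorem exists_isCanonicalCoeff (hX : SpansFibers X) (s : Cₛ^k⟮I; F, V⟯) (x : M) :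
    ∃ c : ι → ℝ, IsCanonicalCoeff (fun i => X i x) (s x) c := by
  let L := (trivializationAt F V x).linearEquivAt ℝ x (FiberBundle.mem_baseSet_trivializationAt' x)
  have hspan : Submodule.span ℝ (range fun i => L (X i x)) = ⊤ :=
    span_range_linearMap_eq_top (hX x) L.surjective
  refine ⟨canonicalCoeff (fun i => L (X i x)) (L (s x)), ?_⟩
  have hL := (isCanonicalCoeff_canonicalCoeff hspan (L (s x))).map L.symm
  simp only [LinearEquiv.symm_apply_apply] at hL
  exact hL

theorem contMDiff_of_isCanonicalCoeff (hX : SpansFibers X) {s : Cₛ^k⟮I; F, V⟯} {c : M → ι → ℝ}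
    (hc : ∀ x, IsCanonicalCoeff (fun i => X i x) (s x) (c x)) (i : ι) :
    ContMDiff I 𝓘(ℝ, ℝ) k fun x => c x i := by
  intro x₀
  let e := trivializationAt F V x₀
  have hx₀ : x₀ ∈ e.baseSet := FiberBundle.mem_baseSet_trivializationAt' x₀
  have hcoord : ∀ t : Cₛ^k⟮I; F, V⟯, ContMDiffAt I 𝓘(ℝ, F) k (fun x => (e ⟨x, t x⟩).2) x₀ :=
    fun t => (contMDiffAt_section x₀).1 (t.contMDiff x₀)
  have hpair : ContMDiffAt I 𝓘(ℝ, (ι → F) × F) k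
      (fun x => (fun i => (e ⟨x, X i x⟩).2, (e ⟨x, s x⟩).2)) x₀ :=
    (contMDiffAt_pi_space.2 fun i => hcoord (X i)).prodMk_space (hcoord s)
  have hspan : ∀ x ∈ e.baseSet, Submodule.span ℝ (range fun i => (e ⟨x, X i x⟩).2) = ⊤ :=
    fun x hx => span_range_linearMap_eq_top (hX x)
      (L := (e.linearEquivAt ℝ x hx).toLinearMap) (e.linearEquivAt ℝ x hx).surjective
  have hcomp :=
    (contDiffAt_canonicalCoeff (hspan x₀ hx₀) (e ⟨x₀, s x₀⟩).2 i).contMDiffAt.comp x₀ hpair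
  refine hcomp.congr_of_eventuallyEq ?_
  filter_upwards [e.open_baseSet.mem_nhds hx₀] with x hx
  have hmap : IsCanonicalCoeff (fun i => (e ⟨x, X i x⟩).2) (e ⟨x, s x⟩).2 (c x) :=
    (hc x).map (e.linearEquivAt ℝ x hx)
  exact congrFun (hmap.eq (isCanonicalCoeff_canonicalCoeff (hspan x hx) _)) i

theorem generatesSections (hX : SpansFibers X) : GeneratesSections X := by
  intro s
  choose c hc using hX.exists_isCanonicalCoeff s
  exact ⟨fun i => ⟨fun x => c x i, hX.contMDiff_of_isCanonicalCoeff hc i⟩,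
    fun x => (hc x).sum_smul.symm⟩

end SpansFibers

end Sections

section DisjointFamilies

theorem exists_isOpen_pairwise_disjoint_of_eventually_eq {X ι : Type*} [PseudoEMetricSpace X]
    {S : Set X} {p : X → ι} (hp : ∀ x ∈ S, ∀ᶠ y in 𝓝[S] x, p y = p x) :
    ∃ W : ι → Set X, (∀ i, IsOpen (W i)) ∧ Pairwise (onFun Disjoint W) ∧ ∀ x ∈ S, x ∈ W (p x) := by
  let near (i : ι) : Set X := S ∩ p ⁻¹' {i}
  let far (i : ι) : Set X := S \ p ⁻¹' {i}
  have hsub : ∀ {i j}, i ≠ j → near j ⊆ far i := fun hij _ hx =>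
    ⟨hx.1, fun hi => hij (hi.symm.trans hx.2)⟩
  refine ⟨fun i => {x | Metric.infEDist x (near i) < Metric.infEDist x (far i)},
    fun i => isOpen_lt Metric.continuous_infEDist Metric.continuous_infEDist,
    fun i j hij => disjoint_left.2 fun x hi hj => ?_, fun x hx => ?_⟩
  · exact lt_asymm (lt_of_lt_of_le hi (Metric.infEDist_anti (hsub hij)))
      (lt_of_lt_of_le hj (Metric.infEDist_anti (hsub hij.symm)))
  · have hzero : Metric.infEDist x (near (p x)) = 0 := Metric.infEDist_zero_of_mem ⟨hx, rfl⟩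
    have hpos : Metric.infEDist x (far (p x)) ≠ 0 := by
      rw [Ne, ← Metric.mem_closure_iff_infEDist_zero, mem_closure_iff_frequently, not_frequently]
      filter_upwards [eventually_nhdsWithin_iff.1 (hp x hx)] with y hy hfar
      exact hfar.2 (hy hfar.1)
    rwa [mem_ofPred_eq, hzero, pos_iff_ne_zero]

variable {X ι : Type*} [TopologicalSpace X] {U : ι → Set X}

/-- The points that lie on the frontier of exactly `k` of the sets `U i`. -/
def frontierStratum (U : ι → Set X) (k : ℕ) : Set X :=
  {x | {i | x ∈ frontier (U i)}.encard = k}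

theorem eventually_setOf_mem_eq_of_mem_frontierStratum (hU : ∀ i, IsOpen (U i))
    (hfin : LocallyFinite U) {k : ℕ} {x : X} (hx : x ∈ frontierStratum U k) :
    ∀ᶠ y in 𝓝[frontierStratum U k] x, {i | y ∈ U i} = {i | x ∈ U i} := by
  have hfrontier : ∀ {z i}, z ∈ frontier (U i) ↔ z ∈ closure (U i) ∧ z ∉ U i := by
    intro z i
    rw [(hU i).frontier_eq, Set.mem_sdiff]
  have hmem : ∀ᶠ y in 𝓝 x, {i | x ∈ U i} ⊆ {i | y ∈ U i} :=
    (eventually_all_finite (hfin.point_finite x)).2 fun i hi => (hU i).mem_nhds hi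
  have hclosure : ∀ᶠ y in 𝓝 x, {i | y ∈ closure (U i)} ⊆ {i | x ∈ closure (U i)} :=
    hfin.closure.eventually_subset (fun i => isClosed_closure) x
  filter_upwards [nhdsWithin_le_nhds hmem, nhdsWithin_le_nhds hclosure, self_mem_nhdsWithin]
    with y hmem hclosure hy
  have hsubset : {i | y ∈ frontier (U i)} ⊆ {i | x ∈ frontier (U i)} := fun i hi =>
    hfrontier.2 ⟨hclosure (hfrontier.1 hi).1, fun hxi => (hfrontier.1 hi).2 (hmem hxi)⟩
  have hfinite : {i | y ∈ frontier (U i)}.Finite :=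
    (hfin.closure.point_finite y).subset fun i hi => frontier_subset_closure hi
  have heq : {i | y ∈ frontier (U i)} = {i | x ∈ frontier (U i)} :=
    hfinite.eq_of_subset_of_encard_le hsubset (hx.trans hy.symm).le
  refine Subset.antisymm (fun i hi => ?_) hmem
  by_contra hxi
  have hxf : x ∈ frontier (U i) := hfrontier.2 ⟨hclosure (subset_closure hi), hxi⟩
  have hyf : y ∈ frontier (U i) := heq.ge hxf
  exact (hfrontier.1 hyf).2 hi

theorem exists_disjoint_refinements_of_encard_frontier_le [TopologicalSpace.PseudoMetrizableSpace X]
    (hU : ∀ i, IsOpen (U i)) (hfin : LocallyFinite U) (hcover : ⋃ i, U i = univ) {d : ℕ}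
    (hd : ∀ x, {i | x ∈ frontier (U i)}.encard ≤ d) :
    ∃ V : Fin (d + 1) → ι → Set X, (∀ k i, IsOpen (V k i)) ∧ (∀ k i, V k i ⊆ U i) ∧
      (∀ k, Pairwise (onFun Disjoint (V k))) ∧ ⋃ k, ⋃ i, V k i = univ := by
  let _ := TopologicalSpace.pseudoMetrizableSpacePseudoMetric X
  have hne : ∀ x, {i | x ∈ U i}.Nonempty := fun x => mem_iUnion.1 (hcover ▸ mem_univ x)
  -- The chosen index depends on `x` only through the set of indices, hence is locally constant
  -- on every stratum.
  have hchoice : ∃ p : X → ι, (∀ x, x ∈ U (p x)) ∧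
      ∀ x y, {i | y ∈ U i} = {i | x ∈ U i} → p y = p x :=
    ⟨fun x => (hne x).some, fun x => (hne x).some_mem, fun x y h => by simp only [h]⟩
  obtain ⟨p, hpU, hp⟩ := hchoice
  choose W hWopen hWdisj hW using fun k : Fin (d + 1) =>
    exists_isOpen_pairwise_disjoint_of_eventually_eq (S := frontierStratum U k) (p := p)
      fun x hx => (eventually_setOf_mem_eq_of_mem_frontierStratum hU hfin hx).mono (hp x)
  refine ⟨fun k i => U i ∩ W k i, fun k i => (hU i).inter (hWopen k i),
    fun k i => inter_subset_left,
    fun k i j hij => (hWdisj k hij).mono inter_subset_right inter_subset_right,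
    eq_univ_of_forall fun x => ?_⟩
  obtain ⟨k, hk, hkd⟩ := ENat.le_natCast_iff.1 (hd x)
  exact mem_iUnion₂.2 ⟨⟨k, by lia⟩, p x, hpU x, hW _ x hk⟩

end DisjointFamilies

section GeneralPosition

variable {E H M : Type*} [NormedAddCommGroup E] [NormedSpace ℝ E] [FiniteDimensional ℝ E]
  [TopologicalSpace H] {I : ModelWithCorners ℝ E H} [TopologicalSpace M] [ChartedSpace H M]

theorem dimH_range_le_finrank_of_contMDiff {G : Type*} [NormedAddCommGroup G] [NormedSpace ℝ G]
    [LindelofSpace M] {g : M → G} (hg : ContMDiff I 𝓘(ℝ, G) 1 g) :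
    dimH (range g) ≤ finrank ℝ E := by
  have hlip : ∀ x, ∃ K, ∃ t ∈ 𝓝[range I] (extChartAt I x x),
      LipschitzOnWith K (g ∘ (extChartAt I x).symm) t := fun x =>
    (contMDiffAt_iff.1 (hg x)).2.exists_lipschitzOnWith I.convex_range
  choose K t ht hlip using hlip
  obtain ⟨s, hs, hcover⟩ := LindelofSpace.elim_nhds_subcover
    (fun x => (extChartAt I x).source ∩ extChartAt I x ⁻¹' t x) fun x =>
      inter_mem (extChartAt_source_mem_nhds x) (map_extChartAt_nhds (I := I) x ▸ ht x :)
  have hrange : range g ⊆ ⋃ x ∈ s, (g ∘ (extChartAt I x).symm) '' t x := by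
    rintro _ ⟨y, rfl⟩
    obtain ⟨x, hx, hyx, hyt⟩ := mem_iUnion₂.1 (hcover.ge (mem_univ y))
    exact mem_iUnion₂.2 ⟨x, hx, _, hyt, congrArg g ((extChartAt I x).left_inv hyx)⟩
  refine (dimH_mono hrange).trans ?_
  rw [dimH_bUnion hs]
  refine iSup₂_le fun x _ => (hlip x).dimH_image_le.trans ?_
  exact (dimH_mono (subset_univ _)).trans (Real.dimH_univ_eq_finrank E).le

theorem isMeagre_range_of_contMDiff {G : Type*} [NormedAddCommGroup G] [NormedSpace ℝ G]
    [FiniteDimensional ℝ G] [SigmaCompactSpace M] {g : M → G} (hg : ContMDiff I 𝓘(ℝ, G) 1 g)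
    (hlt : finrank ℝ E < finrank ℝ G) : IsMeagre (range g) := by
  rw [← image_univ, ← iUnion_compactCovering, image_iUnion]
  refine isMeagre_iUnion fun m => IsNowhereDense.isMeagre ?_
  have hclosed : IsClosed (g '' compactCovering M m) :=
    ((isCompact_compactCovering M m).image hg.continuous).isClosed
  rw [hclosed.isNowhereDense_iff, interior_eq_empty_iff_dense_compl]
  refine dense_compl_of_dimH_lt_finrank ((dimH_mono (image_subset_range _ _)).trans_lt ?_)
  exact (dimH_range_le_finrank_of_contMDiff hg).trans_lt (mod_cast hlt)

theorem isOpenMap_precomp {ι κ Y : Type*} [TopologicalSpace Y] {j : κ → ι} (hj : Injective j) :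
    IsOpenMap fun c : ι → Y => c ∘ j := by
  refine IsOpenMap.of_sections fun c =>
    ⟨fun t => extend j t c, Continuous.continuousAt ?_, ?_, fun t => extend_comp hj t c⟩
  · refine continuous_pi fun i => ?_
    by_cases hi : ∃ k, j k = i
    · obtain ⟨k, rfl⟩ := hi
      simpa only [hj.extend_apply] using continuous_apply k
    · simpa only [extend_apply' _ _ _ hi] using continuous_const
  · funext i
    by_cases hi : ∃ k, j k = i
    · obtain ⟨k, rfl⟩ := hi
      exact hj.extend_apply _ _ k
    · exact extend_apply' _ _ _ hi

theorem exists_levels_in_general_position [SigmaCompactSpace M] {ι : Type*} [Countable ι]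
    {f : ι → M → ℝ} (hf : ∀ i, ContMDiff I 𝓘(ℝ, ℝ) 1 (f i)) {O : Set ℝ} (hO : IsOpen O)
    (hne : O.Nonempty) {d : ℕ} (hd : finrank ℝ E ≤ d) :
    ∃ c : ι → ℝ, (∀ i, c i ∈ O) ∧ ∀ x, {i | f i x = c i}.encard ≤ d := by
  have : PolishSpace O := hO.polishSpace
  have : Nonempty O := hne.to_subtype
  let Js := {s : Finset ι // d < s.card}
  let values (s : Js) (x : M) : s.1 → ℝ := fun i => f i x
  let levels (s : Js) (c : ι → O) : s.1 → ℝ := Pi.map (fun _ => (↑)) (c ∘ (↑))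
  have hopen : ∀ s, IsOpenMap (levels s) := fun s =>
    (IsOpenMap.piMap (fun _ => hO.isOpenMap_subtype_val) (by simp)).comp
      (isOpenMap_precomp Subtype.val_injective)
  have hvalues : ∀ s, IsMeagre (range (values s)) := fun s =>
    isMeagre_range_of_contMDiff (contMDiff_pi_space.2 fun i => hf i)
      (by simpa using hd.trans_lt s.2)
  have hmeagre : IsMeagre (⋃ s, levels s ⁻¹' range (values s)) :=
    isMeagre_iUnion fun s => (hvalues s).preimage_of_isOpenMap (by fun_prop) (hopen s)
  obtain ⟨c, hc⟩ := (dense_of_mem_residual hmeagre).nonempty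
  refine ⟨fun i => c i, fun i => (c i).2, fun x => ?_⟩
  by_contra! hx
  obtain ⟨s, hs, hcard⟩ := exists_subset_encard_eq (Order.add_one_le_of_lt hx)
  lift s to Finset ι using finite_of_encard_eq_coe (k := d + 1) hcard
  rw [encard_coe_eq_coe_finsetCard] at hcard
  have hlt : d < s.card := by exact_mod_cast hcard.ge
  exact hc (mem_iUnion.2 ⟨⟨s, hlt⟩, x, funext fun i => hs i.2⟩)

end GeneralPosition

section GeneralPositionCovers

universe u

theorem exists_open_refinement_encard_frontier_le {E H : Type*} {M : Type u}
    [NormedAddCommGroup E] [NormedSpace ℝ E] [FiniteDimensional ℝ E] [TopologicalSpace H]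
    (I : ModelWithCorners ℝ E H) [TopologicalSpace M] [T2Space M] [SigmaCompactSpace M]
    [ChartedSpace H M] [IsManifold I ∞ M] {d : ℕ} (hd : finrank ℝ E ≤ d) {N : M → Set M}
    (hN : ∀ x, N x ∈ 𝓝 x) :
    ∃ (ι : Type u) (c : ι → M) (U : ι → Set M), (∀ i, IsOpen (U i)) ∧ (∀ i, U i ⊆ N (c i)) ∧
      LocallyFinite U ∧ ⋃ i, U i = univ ∧ ∀ x, {i | x ∈ frontier (U i)}.encard ≤ d := by
  obtain ⟨ι, f, hfN⟩ := SmoothBumpCovering.exists_isSubordinate I isClosed_univ fun x _ => hN x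
  have : Countable ι := countable_univ_iff.1
    (f.locallyFinite.countable_univ fun i => (f i).nonempty_support)
  obtain ⟨c, hc, hlevels⟩ := exists_levels_in_general_position
    (fun i => (f i).contMDiff.of_le (by simp)) (isOpen_Ioo (a := (0 : ℝ)) (b := 1))
    (nonempty_Ioo.2 one_pos) hd
  have hsupport : ∀ i, {x | c i < f i x} ⊆ support (f i) :=
    fun i x hx => ((hc i).1.trans hx).ne'
  refine ⟨ι, f.c, fun i => {x | c i < f i x}, fun i => isOpen_lt continuous_const (f i).continuous,
    fun i => (hsupport i).trans (hfN.support_subset i), f.locallyFinite.subset hsupport,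
    eq_univ_of_forall fun x => mem_iUnion.2 ⟨f.ind x (mem_univ x), ?_⟩,
    fun x => (encard_le_encard fun i hi => ?_).trans (hlevels x)⟩
  · exact (hc _).2.trans_eq (f.apply_ind x (mem_univ x)).symm
  · exact (frontier_lt_subset_eq continuous_const (f i).continuous hi).symm

end GeneralPositionCovers

section LocalFrames

open Bundle

variable {ι κ E H : Type*} [NormedAddCommGroup E] [NormedSpace ℝ E] [TopologicalSpace H]
  {I : ModelWithCorners ℝ E H} {F M : Type*} {V : M → Type*} {k : ℕ∞ω} [NormedAddCommGroup F]
  [NormedSpace ℝ F] [TopologicalSpace M] [ChartedSpace H M] [TopologicalSpace (TotalSpace F V)]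
  [∀ x, AddCommGroup (V x)] [∀ x, Module ℝ (V x)] [∀ x, TopologicalSpace (V x)]
  [FiberBundle F V]

theorem exists_isLocalFrameOn_iUnion {U : ι → Set M} (hU : ∀ i, IsOpen (U i))
    (hdisj : Pairwise (onFun Disjoint U)) {s : ι → κ → (x : M) → V x}
    (hs : ∀ i, IsLocalFrameOn I F k (s i) (U i)) :
    ∃ t : κ → (x : M) → V x, IsLocalFrameOn I F k t (⋃ i, U i) := by
  classical
  let t (a : κ) (x : M) : V x := if h : ∃ i, x ∈ U i then s h.choose a x else 0
  have ht : ∀ i, IsLocalFrameOn I F k t (U i) := by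
    refine fun i => (hs i).congr fun a x hx => ?_
    have h : ∃ i, x ∈ U i := ⟨i, hx⟩
    have hi : h.choose = i := hdisj.eq (not_disjoint_iff.2 ⟨x, h.choose_spec, hx⟩)
    simp only [t, dif_pos h, hi]
  refine ⟨t, ⟨fun {x} hx => ?_, fun {x} hx => ?_, fun a x hx => ?_⟩⟩ <;>
    obtain ⟨i, hi⟩ := mem_iUnion.1 hx
  · exact (ht i).linearIndependent hi
  · exact (ht i).generating hi
  · exact ((ht i).contMDiffAt (hU i) hi a).contMDiffWithinAt

variable (I F k) in
/-- An open cover `U` of the base of a vector bundle with a `C^k` local frame `s i` over each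
`U i`; the values of `s i` off `U i` are irrelevant. -/
structure IsLocalFrameCover (U : ι → Set M) (s : ι → κ → (x : M) → V x) : Prop where
  isOpen : ∀ i, IsOpen (U i)
  iUnion_eq : ⋃ i, U i = univ
  isLocalFrameOn : ∀ i, IsLocalFrameOn I F k (s i) (U i)

namespace IsLocalFrameCover

variable {U : ι → Set M} {s : ι → κ → (x : M) → V x}

theorem exists_spansFibers [VectorBundle ℝ F V] (hk : k ≤ ∞) (hU : IsLocalFrameCover I F k U s)
    {ψ : SmoothPartitionOfUnity ι I M} (hψ : ψ.IsSubordinate U) :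
    ∃ X : ι × κ → Cₛ^k⟮I; F, V⟯, (∀ i j x, X (i, j) x = ψ i x • s i j x) ∧ SpansFibers X := by
  refine ⟨fun p => ⟨fun x => ψ p.1 x • s p.1 p.2 x,
    ContMDiffOn.smul_section_of_tsupport ((ψ p.1).contMDiff.of_le hk).contMDiffOn
      (hU.isOpen p.1) (hψ p.1) ((hU.isLocalFrameOn p.1).contMDiffOn p.2)⟩,
    fun i j x => rfl, fun x => ?_⟩
  obtain ⟨i, hi⟩ := ψ.exists_pos_of_mem (mem_univ x)
  have hxU : x ∈ U i := hψ i (subset_closure hi.ne')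
  refine top_le_iff.1 (((hU.isLocalFrameOn i).generating hxU).trans (Submodule.span_le.2 ?_))
  rintro _ ⟨j, rfl⟩
  exact (Submodule.smul_mem_iff _ hi.ne').1 (Submodule.subset_span ⟨(i, j), rfl⟩)

end IsLocalFrameCover

variable [FiniteDimensional ℝ E] [T2Space M] [SigmaCompactSpace M] [IsManifold I ∞ M]

theorem IsLocalFrameCover.exists_smoothPartitionOfUnity {U : ι → Set M}
    {s : ι → κ → (x : M) → V x} (hU : IsLocalFrameCover I F k U s) :
    ∃ ψ : SmoothPartitionOfUnity ι I M, ψ.IsSubordinate U :=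
  SmoothPartitionOfUnity.exists_isSubordinate I isClosed_univ U hU.isOpen hU.iUnion_eq.ge

theorem exists_isLocalFrameCover [VectorBundle ℝ F V] [ContMDiffVectorBundle k F V I]
    (b : Basis κ ℝ F) {d : ℕ} (hd : finrank ℝ E ≤ d) :
    ∃ (U : Fin (d + 1) → Set M) (s : Fin (d + 1) → κ → (x : M) → V x),
      IsLocalFrameCover I F k U s := by
  have := Manifold.metrizableSpace I M
  obtain ⟨_, c, W, hWopen, hWsub, hWfin, hWcover, hWd⟩ :=
    exists_open_refinement_encard_frontier_le I hd fun x : M =>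
      (trivializationAt F V x).open_baseSet.mem_nhds (FiberBundle.mem_baseSet_trivializationAt' x)
  obtain ⟨U, hUopen, hUW, hUdisj, hUcover⟩ :=
    exists_disjoint_refinements_of_encard_frontier_le hWopen hWfin hWcover hWd
  have hframe : ∀ l, ∃ t : κ → (x : M) → V x, IsLocalFrameOn I F k t (⋃ i, U l i) := fun l =>
    exists_isLocalFrameOn_iUnion (hUopen l) (hUdisj l) fun i =>
      ((trivializationAt F V (c i)).isLocalFrameOn_localFrame_baseSet I k b).mono
        ((hUW l i).trans (hWsub i))
  choose s hs using hframe
  exact ⟨fun l => ⋃ i, U l i, s, fun l => isOpen_iUnion (hUopen l), hUcover, hs⟩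

end LocalFrames

section TangentBundle

variable {n : ℕ} {M : Type*} [TopologicalSpace M] [ChartedSpace (EuclideanSpace ℝ (Fin n)) M]
  [IsManifold (𝓡 n) ∞ M]

namespace SmoothVectorField

theorem spansTangentSpaces_iff {ι : Type*} {X : ι → SmoothVectorField n M} :
    SpansTangentSpaces X ↔ SpansFibers X :=
  Iff.rfl

theorem sum_smul_apply {ι : Type*} [Fintype ι] (f : ι → SmoothFunction n M)
    (X : ι → SmoothVectorField n M) (x : M) : (∑ i, f i • X i) x = ∑ i, f i x • X i x :=
  (congrFun (map_sum (ContMDiffSection.coeAddHom (𝓡 n) (EuclideanSpace ℝ (Fin n)) ∞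
    fun x : M => TangentSpace (𝓡 n) x) (fun i => f i • X i) Finset.univ) x).trans
    (Finset.sum_apply x _ _)

theorem isGeneratingFamily_iff {ι : Type*} [Fintype ι] {X : ι → SmoothVectorField n M} :
    IsGeneratingFamily X ↔ GeneratesSections X := by
  refine forall_congr' fun V => exists_congr fun f => ?_
  simp only [ContMDiffSection.ext_iff, sum_smul_apply]

theorem moduleFinite_iff_exists_isGeneratingFamily :
    Module.Finite (SmoothFunction n M) (SmoothVectorField n M) ↔
      ∃ (m : ℕ) (X : Fin m → SmoothVectorField n M), IsGeneratingFamily X := by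
  rw [Module.finite_def, Submodule.fg_iff_exists_fin_generating_family]
  refine exists_congr fun m => exists_congr fun X => ?_
  simp only [IsGeneratingFamily, Submodule.eq_top_iff', Submodule.mem_span_range_iff_exists_fun,
    eq_comm]

end SmoothVectorField

theorem isTrivialisingCover_iff {ι : Type*} {U : ι → Set M}
    {E : ι → Fin n → (x : M) → TangentSpace (𝓡 n) x} :
    IsTrivialisingCover U E ↔ IsLocalFrameCover (𝓡 n) (EuclideanSpace ℝ (Fin n)) ∞ U E :=
  ⟨fun h => ⟨h.isOpen, h.iUnion_eq, h.isLocalFrameOn⟩,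
    fun h => ⟨h.isOpen, h.iUnion_eq, h.isLocalFrameOn⟩⟩

end TangentBundle

section VectorBundles

open Bundle

variable {κ E H F M : Type*} {V : M → Type*} [NormedAddCommGroup E] [NormedSpace ℝ E]
  [TopologicalSpace H] {I : ModelWithCorners ℝ E H} {k : ℕ∞ω} [NormedAddCommGroup F]
  [NormedSpace ℝ F] [TopologicalSpace M] [ChartedSpace H M] [TopologicalSpace (TotalSpace F V)]
  [∀ x, AddCommGroup (V x)] [∀ x, Module ℝ (V x)] [∀ x, TopologicalSpace (V x)]
  [FiberBundle F V] [VectorBundle ℝ F V]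

theorem mainTheorem4_general [IsManifold I ∞ M] [ContMDiffVectorBundle k F V I] (hk : k ≤ ∞) :
    (∀ (m : ℕ) (X : Fin m → Cₛ^k⟮I; F, V⟯), SpansFibers X → GeneratesSections X) ∧
    ∀ [FiniteDimensional ℝ E] [T2Space M] [SigmaCompactSpace M] [Fintype κ] (_ : Basis κ ℝ F)
      (d : ℕ), finrank ℝ E ≤ d →
      (∃ (m : ℕ) (X : Fin m → Cₛ^k⟮I; F, V⟯), GeneratesSections X) ∧
      (∃ (U : Fin (d + 1) → Set M) (s : Fin (d + 1) → κ → (x : M) → V x),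
        IsLocalFrameCover I F k U s) ∧
      ∀ (U : Fin (d + 1) → Set M) (s : Fin (d + 1) → κ → (x : M) → V x),
        IsLocalFrameCover I F k U s →
          (∃ ψ : SmoothPartitionOfUnity (Fin (d + 1)) I M, ψ.IsSubordinate U) ∧
          ∀ ψ : SmoothPartitionOfUnity (Fin (d + 1)) I M, ψ.IsSubordinate U →
            ∃ X : Fin (d + 1) × κ → Cₛ^k⟮I; F, V⟯,
              (∀ i j x, X (i, j) x = ψ i x • s i j x) ∧ SpansFibers X ∧ GeneratesSections X := by
  refine ⟨fun m X hX => hX.generatesSections, fun {_ _ _ _} b d hd => ?_⟩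
  obtain ⟨U, s, hU⟩ := exists_isLocalFrameCover (I := I) (k := k) (V := V) b hd
  obtain ⟨ψ, hψ⟩ := hU.exists_smoothPartitionOfUnity
  obtain ⟨X, -, hX⟩ := hU.exists_spansFibers hk hψ
  refine ⟨hX.generatesSections.exists_fin, ⟨U, s, hU⟩,
    fun U s hU => ⟨hU.exists_smoothPartitionOfUnity, fun ψ hψ => ?_⟩⟩
  obtain ⟨X, hXs, hX⟩ := hU.exists_spansFibers hk hψ
  exact ⟨X, hXs, hX, hX.generatesSections⟩

end VectorBundles

theorem mainTheorem4 (n : ℕ) (M : Type*) [TopologicalSpace M] [T2Space M]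
    [ChartedSpace (EuclideanSpace ℝ (Fin n)) M] [IsManifold (𝓡 n) ∞ M] :
    -- finitely many vector fields that span every tangent space form a generating set
    (∀ (m : ℕ) (X : Fin m → SmoothVectorField n M),
      SmoothVectorField.SpansTangentSpaces X → SmoothVectorField.IsGeneratingFamily X) ∧
    (SecondCountableTopology M →
      -- the module of smooth vector fields is finitely generated
      Module.Finite (SmoothFunction n M) (SmoothVectorField n M) ∧
      -- there is a trivialising cover by `n + 1` open sets
      (∃ (U : Fin (n + 1) → Set M)
          (E : Fin (n + 1) → Fin n → (x : M) → TangentSpace (𝓡 n) x),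
        IsTrivialisingCover U E) ∧
      -- for each such cover, with its local frames, there is a smooth partition of unity
      -- subordinate to it, and each one multiplies the frames to global smooth vector fields
      -- that span every tangent space and form a generating set
      (∀ (U : Fin (n + 1) → Set M)
          (E : Fin (n + 1) → Fin n → (x : M) → TangentSpace (𝓡 n) x),
        IsTrivialisingCover U E →
          (∃ ψ : SmoothPartitionOfUnity (Fin (n + 1)) (𝓡 n) M, ψ.IsSubordinate U) ∧
          ∀ ψ : SmoothPartitionOfUnity (Fin (n + 1)) (𝓡 n) M, ψ.IsSubordinate U →
            ∃ X : Fin (n + 1) × Fin n → SmoothVectorField n M,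
              (∀ i j x, X (i, j) x = ψ i x • E i j x) ∧
              SmoothVectorField.SpansTangentSpaces X ∧
              SmoothVectorField.IsGeneratingFamily X)) := by
  have := ChartedSpace.locallyCompactSpace (EuclideanSpace ℝ (Fin n)) M
  simp only [SmoothVectorField.moduleFinite_iff_exists_isGeneratingFamily,
    SmoothVectorField.spansTangentSpaces_iff, SmoothVectorField.isGeneratingFamily_iff,
    isTrivialisingCover_iff]
  exact (mainTheorem4_general le_rfl).imp_right fun h _ =>
    h (EuclideanSpace.basisFun (Fin n) ℝ).toBasis n finrank_euclideanSpace_fin.le
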